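/- Let $\mathbb{D}\in\{\mathbb{R},\mathbb{C},\mathbb{H}\}$, let $p,q\ge 0$ and $n=p+q$, and let $J=\mathrm{diag}(\mathrm{Id}_p,-\mathrm{Id}_q)\in \mathrm{Mat}_n(\mathbb{D})$. Write $X^{*}=\overline{X}^{t}$ and call a Hermitian matrix $X\in\mathrm{Mat}_n(\mathbb D)$ positive if $(Xu)^{*}u>0$ for all nonzero $u\in\mathbb{D}^n$. Let $\mathscr{P}$ be the set of positive Hermitian matrices, let $$\mathfrak{p}_J=\{X\in \mathrm{Mat}_n(\mathbb{D}) : JX^{*}J=X\},\qquad \mathscr{P}_J=\{X\in\mathfrak{p}_J : JX \text{ is positive}\},$$ and put $X\bullet Y=XJY$ and $\exp_J(X)=J\exp(JX)$. On $\mathscr{P}$ consider the metric $\langle U,V\rangle_P=\widetilde{\mathrm{tr}}(P^{-1}UP^{-1}V)$ for Hermitian $U,V$, where $\widetilde{\mathrm{tr}}=\mathrm{tr}$ if $\mathbb{D}\in\{\mathbb{R},\mathbb{C}\}$ (the value is then real) and $\widetilde{\mathrm{tr}}=\mathrm{Re}\,\mathrm{tr}$ (the reduced trace) if $\mathbb{D}=\mathbb{H}$.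 Let $\omega$ be its pullback under $X\mapsto JX$, that is, $\omega_P(U,V)=\langle JU,JV\rangle_{JP}$ for $P\in\mathscr{P}_J$ and $U,V\in\mathfrak{p}_J\cong T_P\mathscr{P}_J$. **Theorem.** The map $\exp_J$ restricts to a bijection $\mathfrak{p}_J\to\mathscr{P}_J$; write $\log_J$ for its inverse and $X_J^t=\exp_J(t\log_J X)$ for $X\in\mathscr{P}_J$, $t\in\mathbb{R}$. The set $\mathscr{P}_J$ is open in the real vector space $\mathfrak{p}_J$, and $\omega$ is a smooth Riemannian metric on it. For all $A,B\in\mathscr{P}_J$, the curve $$\gamma(t)=A_J^{1/2}\bullet\bigl(A_J^{-1/2}\bullet B\bullet A_J^{-1/2}\bigr)_J^{t}\bullet A_J^{1/2},\qquad t\in[0,1],$$ is the geodesic from $A$ to $B$ in $(\mathscr{P}_J,\omega)$: it is a smooth curve in $\mathscr{P}_J$ with $\gamma(0)=A$ and $\gamma(1)=B$, it satisfies the geodesic equation $\nabla_{\dot\gamma}\dot\gamma=0$ for the Levi-Civita connection $\nabla$ of $\omega$, and every smooth curve $\delta:[0,1]\to\mathscr{P}_J$ with $\delta(0)=A$, $\delta(1)=B$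 and $\nabla_{\dot\delta}\dot\delta=0$ equals $\gamma$. -/

import Mathlib

open scoped ContDiff Matrix

attribute [local instance] Matrix.linftyOpNormedRing Matrix.linftyOpNormedAlgebra

noncomputable section

/-! ### Geodesics of a Riemannian metric on a relatively open subset of a linear subspace -/

namespace FlatChart

/-- `g` is a (smooth) Riemannian metric on `Ω`, a relatively open subset of the linear subspace `T`
of a real normed space `E`. Every tangent space of `Ω` is identified with `T`; the number `g P U V`
is the inner product of the tangent vectors `U, V ∈ T` at the point `P ∈ Ω`. -/
structure IsRiemannianMetric {E : Type*} [NormedAddCommGroup E] [NormedSpace ℝ E]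
    (T : Submodule ℝ E) (Ω : Set E) (g : E → E → E → ℝ) : Prop where
  subset : Ω ⊆ (T : Set E)
  isOpen : IsOpen {x : T | (x : E) ∈ Ω}
  add_left : ∀ P ∈ Ω, ∀ U ∈ T, ∀ V ∈ T, ∀ W ∈ T, g P (U + V) W = g P U W + g P V W
  smul_left : ∀ P ∈ Ω, ∀ a : ℝ, ∀ U ∈ T, ∀ V ∈ T, g P (a • U) V = a * g P U V
  symm : ∀ P ∈ Ω, ∀ U ∈ T, ∀ V ∈ T, g P U V = g P V U
  pos : ∀ P ∈ Ω, ∀ U ∈ T, U ≠ 0 → 0 < g P U U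
  smooth : ∀ U ∈ T, ∀ V ∈ T, ContDiffOn ℝ ∞ (fun P => g P U V) Ω

/-- The Christoffel symbol of the first kind of the Levi-Civita connection of `g` at `P`, given by
the Koszul formula for constant vector fields:
`(∂_U g(V, W) + ∂_V g(U, W) - ∂_W g(U, V)) / 2`, which is `g_P(Γ_P(U, V), W)`. -/
def christoffel {E : Type*} [NormedAddCommGroup E] [NormedSpace ℝ E]
    (g : E → E → E → ℝ) (P U V W : E) : ℝ :=
  (lineDeriv ℝ (fun X => g X V W) P U + lineDeriv ℝ (fun X => g X U W) P V
    - lineDeriv ℝ (fun X => g X U V) P W) / 2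

/-- `γ` restricts to a geodesic `[0, 1] → Ω` of `g` from `A` to `B`: it is smooth and satisfies
the geodesic equation `∇_γ' γ' = 0` of the Levi-Civita connection, that is,
`g_γ(γ'', W) + g_γ(Γ_γ(γ', γ'), W) = 0` for all tangent vectors `W`. -/
structure IsGeodesicFromTo {E : Type*} [NormedAddCommGroup E] [NormedSpace ℝ E]
    (T : Submodule ℝ E) (Ω : Set E) (g : E → E → E → ℝ) (A B : E) (γ : ℝ → E) : Prop where
  mem : ∀ t ∈ Set.Icc (0 : ℝ) 1, γ t ∈ Ω
  smooth : ContDiffOn ℝ ∞ γ (Set.Icc 0 1)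
  source : γ 0 = A
  target : γ 1 = B
  equation : ∀ t ∈ Set.Icc (0 : ℝ) 1, ∀ W ∈ T,
    g (γ t) (iteratedDerivWithin 2 γ (Set.Icc 0 1) t) W
      + christoffel g (γ t) (derivWithin γ (Set.Icc 0 1) t) (derivWithin γ (Set.Icc 0 1) t) W = 0

end FlatChart

/-! ### The cone of `J`-positive matrices -/

namespace JCone

/-- The real part of a scalar; only the three instances below are used. -/
class RealPart (𝔻 : Type) where
  re : 𝔻 → ℝ

instance : RealPart ℝ := ⟨fun x => x⟩

instance : RealPart ℂ := ⟨fun z => z.re⟩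

instance : RealPart (Quaternion ℝ) := ⟨fun x => x.re⟩

instance : StarModule ℝ (Quaternion ℝ) :=
  ⟨fun r x => by rw [Quaternion.star_smul, star_trivial r]⟩

/-- Square matrices of size `n = p + q`, in block form. -/
abbrev Mat (𝔻 : Type) (p q : ℕ) : Type := Matrix (Fin p ⊕ Fin q) (Fin p ⊕ Fin q) 𝔻

/-- The signature matrix `J = diag(Id_p, -Id_q)`. -/
def sgn (𝔻 : Type) [NormedDivisionRing 𝔻] (p q : ℕ) : Mat 𝔻 p q :=
  Matrix.fromBlocks 1 0 0 (-1)

/-- A Hermitian matrix `X` is positive if `(X u)* u > 0` for all nonzero vectors `u`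
(this number is real when `X` is Hermitian). -/
def IsPositive {𝔻 : Type} [NormedDivisionRing 𝔻] [StarRing 𝔻] [RealPart 𝔻] {p q : ℕ}
    (X : Mat 𝔻 p q) : Prop :=
  X.IsHermitian ∧ ∀ u : Fin p ⊕ Fin q → 𝔻, u ≠ 0 → 0 < RealPart.re (star (X *ᵥ u) ⬝ᵥ u)

/-- The real vector space of `J`-Hermitian matrices: `J X* J = X`. -/
def jHermitian (𝔻 : Type) [NormedDivisionRing 𝔻] [StarRing 𝔻] [NormedAlgebra ℝ 𝔻]
    [StarModule ℝ 𝔻] (p q : ℕ) : Submodule ℝ (Mat 𝔻 p q) where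
  carrier := {X | sgn 𝔻 p q * Xᴴ * sgn 𝔻 p q = X}
  add_mem' := by
    intro X Y hX hY
    simp only [Set.mem_ofPred_eq] at hX hY ⊢
    rw [Matrix.conjTranspose_add, Matrix.mul_add, Matrix.add_mul, hX, hY]
  zero_mem' := by simp
  smul_mem' := by
    intro c X hX
    simp only [Set.mem_ofPred_eq] at hX ⊢
    rw [Matrix.conjTranspose_smul, star_trivial, Matrix.mul_smul, Matrix.smul_mul, hX]

/-- The cone of `J`-positive matrices: the `J`-Hermitian `X` such that `J X` is positive. -/
def jPositive (𝔻 : Type) [NormedDivisionRing 𝔻] [StarRing 𝔻] [NormedAlgebra ℝ 𝔻]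
    [StarModule ℝ 𝔻] [RealPart 𝔻] (p q : ℕ) : Set (Mat 𝔻 p q) :=
  {X | X ∈ jHermitian 𝔻 p q ∧ IsPositive (sgn 𝔻 p q * X)}

/-- The trace for real and complex matrices (whose value is real wherever it is used below), the
reduced trace, i.e. the real part of the trace, for quaternionic matrices. -/
def redTrace {𝔻 : Type} [NormedDivisionRing 𝔻] [RealPart 𝔻] {p q : ℕ} (X : Mat 𝔻 p q) : ℝ :=
  RealPart.re X.trace

/-- The trace metric `⟨U, V⟩_P = tr(P⁻¹ U P⁻¹ V)` on positive matrices. -/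
def traceMetric {𝔻 : Type} [NormedDivisionRing 𝔻] [RealPart 𝔻] {p q : ℕ} (P U V : Mat 𝔻 p q) : ℝ :=
  redTrace (Ring.inverse P * U * Ring.inverse P * V)

/-- The pullback of the trace metric under the linear map `X ↦ J X`. -/
def jMetric {𝔻 : Type} [NormedDivisionRing 𝔻] [RealPart 𝔻] {p q : ℕ} (P U V : Mat 𝔻 p q) : ℝ :=
  traceMetric (sgn 𝔻 p q * P) (sgn 𝔻 p q * U) (sgn 𝔻 p q * V)

/-- The product `X • Y = X J Y`. -/
def jMul {𝔻 : Type} [NormedDivisionRing 𝔻] {p q : ℕ} (X Y : Mat 𝔻 p q) : Mat 𝔻 p q :=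
  X * sgn 𝔻 p q * Y

/-- The `J`-exponential `exp_J(X) = J exp(J X)`. -/
def jExp {𝔻 : Type} [NormedDivisionRing 𝔻] [NormedAlgebra ℝ 𝔻] {p q : ℕ} (X : Mat 𝔻 p q) :
    Mat 𝔻 p q :=
  sgn 𝔻 p q * NormedSpace.exp (sgn 𝔻 p q * X)

/-- The `J`-logarithm, the inverse of `exp_J` restricted to the `J`-Hermitian matrices. -/
def jLog {𝔻 : Type} [NormedDivisionRing 𝔻] [StarRing 𝔻] [NormedAlgebra ℝ 𝔻] [StarModule ℝ 𝔻]
    {p q : ℕ} : Mat 𝔻 p q → Mat 𝔻 p q :=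
  Function.invFunOn jExp (jHermitian 𝔻 p q : Set (Mat 𝔻 p q))

/-- The `J`-power `X_J^t = exp_J(t log_J X)`. -/
def jPow {𝔻 : Type} [NormedDivisionRing 𝔻] [StarRing 𝔻] [NormedAlgebra ℝ 𝔻] [StarModule ℝ 𝔻]
    {p q : ℕ} (X : Mat 𝔻 p q) (t : ℝ) : Mat 𝔻 p q :=
  jExp (t • jLog X)

/-- The curve `t ↦ A_J^{1/2} • (A_J^{-1/2} • B • A_J^{-1/2})_J^t • A_J^{1/2}`. -/
def jCurve {𝔻 : Type} [NormedDivisionRing 𝔻] [StarRing 𝔻] [NormedAlgebra ℝ 𝔻] [StarModule ℝ 𝔻]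
    {p q : ℕ} (A B : Mat 𝔻 p q) (t : ℝ) : Mat 𝔻 p q :=
  jMul (jMul (jPow A (1 / 2))
    (jPow (jMul (jMul (jPow A (-(1 / 2))) B) (jPow A (-(1 / 2)))) t)) (jPow A (1 / 2))

end JCone

end

set_option linter.unusedSectionVars false

noncomputable section

namespace JCone

open Module

/-! Left multiplication by `J` is a real-linear bijection from the `J`-Hermitian matrices onto the
Hermitian ones. It carries the cone onto the positive matrices, `exp_J` to `exp` and `ω` to the
trace metric, and the factors `J` in `•` cancel. The statement therefore reduces to the classical
one: positive matrices `P`, `Q` are joined by `P^{1/2} (P^{-1/2} Q P^{-1/2})^t P^{1/2}`.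

The three scalar algebras are treated at once. A Hermitian matrix is a symmetric operator on the
real Euclidean space `𝔻^n` (`exists_basis_eigenvectors`), and interpolating polynomials replace the
functional calculus; this shows that `exp` maps the Hermitian matrices bijectively onto the positive
ones (`bijOn_jExp`).

For `Y = J γ`, the Koszul formula turns the geodesic equation into `Y'' = Y' Y⁻¹ Y'`
(`jMetric_add_christoffel`, `eq_of_geodesic_equation`). This says that `Y⁻¹ Y'` is constant, so
`Y(t) = S exp(tK) S` with `S² = J A` and `K` Hermitian. The endpoint `B` fixes `exp K`, and
injectivity of `exp` on Hermitian matrices fixes `K`. -/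

/-- The properties of `ℝ`, `ℂ` and `ℍ`, with their real parts, that the spectral theory of
Hermitian matrices rests on. -/
class StarDivisionAlgebra (𝔻 : Type) [NormedDivisionRing 𝔻] [StarRing 𝔻] [NormedAlgebra ℝ 𝔻]
    [RealPart 𝔻] : Prop where
  finiteDimensional : FiniteDimensional ℝ 𝔻
  re_add : ∀ a b : 𝔻, RealPart.re (a + b) = RealPart.re a + RealPart.re b
  re_smul : ∀ (r : ℝ) (a : 𝔻), RealPart.re (r • a) = r * RealPart.re a
  re_mul_comm : ∀ a b : 𝔻, RealPart.re (a * b) = RealPart.re (b * a)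
  re_star : ∀ a : 𝔻, RealPart.re (star a) = RealPart.re a
  re_star_mul_self : ∀ a : 𝔻, RealPart.re (star a * a) = ‖a‖ ^ 2

instance : StarDivisionAlgebra ℝ where
  finiteDimensional := inferInstance
  re_add _ _ := rfl
  re_smul _ _ := rfl
  re_mul_comm a b := mul_comm a b
  re_star _ := rfl
  re_star_mul_self a := by simp [RealPart.re, sq]

instance : StarDivisionAlgebra ℂ where
  finiteDimensional := inferInstance
  re_add _ _ := rfl
  re_smul r a := Complex.smul_re r a
  re_mul_comm a b := congrArg Complex.re (mul_comm a b)
  re_star _ := rfl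
  re_star_mul_self a := by
    simp [RealPart.re, ← Complex.normSq_eq_norm_sq, Complex.normSq_apply]

instance : StarDivisionAlgebra (Quaternion ℝ) where
  finiteDimensional := inferInstance
  re_add _ _ := rfl
  re_smul _ _ := rfl
  re_mul_comm a b := by simp only [RealPart.re, Quaternion.re_mul]; ring
  re_star _ := Quaternion.re_star _
  re_star_mul_self a := by
    rw [sq, ← Quaternion.normSq_eq_norm_mul_self, Quaternion.star_mul_self]
    simp [RealPart.re]

variable {𝔻 : Type} [NormedDivisionRing 𝔻] [StarRing 𝔻] [NormedAlgebra ℝ 𝔻] [StarModule ℝ 𝔻]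
  [RealPart 𝔻] [StarDivisionAlgebra 𝔻] {p q : ℕ}

instance : FiniteDimensional ℝ 𝔻 := StarDivisionAlgebra.finiteDimensional

/-! ### Spectral calculus for Hermitian matrices through real eigenbases. -/

/-- The real part as a linear map. -/
def reL (𝔻 : Type) [NormedDivisionRing 𝔻] [StarRing 𝔻] [NormedAlgebra ℝ 𝔻]
    [RealPart 𝔻] [StarDivisionAlgebra 𝔻] : 𝔻 →ₗ[ℝ] ℝ where
  toFun := RealPart.re
  map_add' := StarDivisionAlgebra.re_add
  map_smul' := StarDivisionAlgebra.re_smul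

/-- The real inner product `Re (a* b)` on the scalars. -/
abbrev scalarInner (𝔻 : Type) [NormedDivisionRing 𝔻] [StarRing 𝔻] [NormedAlgebra ℝ 𝔻]
    [StarModule ℝ 𝔻] [RealPart 𝔻] [StarDivisionAlgebra 𝔻] : InnerProductSpace ℝ 𝔻 where
  inner a b := RealPart.re (star a * b)
  norm_sq_eq_re_inner a := (StarDivisionAlgebra.re_star_mul_self a).symm
  conj_inner_symm a b := by
    rw [conj_trivial, ← StarDivisionAlgebra.re_star, star_mul, star_star]
  add_left a b c := by rw [star_add, add_mul, StarDivisionAlgebra.re_add]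
  smul_left a b r := by
    rw [star_smul, smul_mul_assoc, StarDivisionAlgebra.re_smul]; rfl

theorem re_sum {ι : Type*} (s : Finset ι) (f : ι → 𝔻) :
    RealPart.re (∑ i ∈ s, f i) = ∑ i ∈ s, RealPart.re (f i) := map_sum (reL 𝔻) f s

/-- For the real inner product `Re (x* y)` the operator `u ↦ X u` is symmetric, so the real spectral
theorem applies. Working over `ℝ` avoids eigenvalue theory over noncommutative scalars. -/
theorem exists_basis_eigenvectors {X : Mat 𝔻 p q} (hX : X.IsHermitian) :
    ∃ (n : ℕ) (b : Basis (Fin n) ℝ (Fin p ⊕ Fin q → 𝔻)) (l : Fin n → ℝ),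
      ∀ i, X *ᵥ b i = l i • b i := by
  let _ := scalarInner 𝔻
  let E := PiLp 2 (fun _ : Fin p ⊕ Fin q => 𝔻)
  let e : E ≃ₗ[ℝ] (Fin p ⊕ Fin q → 𝔻) := WithLp.linearEquiv 2 ℝ _
  let M : (Fin p ⊕ Fin q → 𝔻) →ₗ[ℝ] (Fin p ⊕ Fin q → 𝔻) :=
    { toFun := fun u => X *ᵥ u
      map_add' := Matrix.mulVec_add X
      map_smul' := fun r u => Matrix.mulVec_smul X r u }
  let T : E →ₗ[ℝ] E := e.symm.toLinearMap ∘ₗ M ∘ₗ e.toLinearMap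
  have hin : ∀ x y : E, inner ℝ x y = RealPart.re (star (e x) ⬝ᵥ e y) := by
    intro x y
    rw [PiLp.inner_apply, dotProduct, re_sum]
    rfl
  have hT : T.IsSymmetric := by
    intro x y
    rw [hin, hin]
    have h1 : e (T x) = X *ᵥ e x := by simp [T, M]
    have h2 : e (T y) = X *ᵥ e y := by simp [T, M]
    rw [h1, h2, Matrix.star_mulVec, hX.eq, Matrix.dotProduct_mulVec]
  have : FiniteDimensional ℝ E := e.symm.finiteDimensional
  refine ⟨_, (hT.eigenvectorBasis rfl).toBasis.map e, hT.eigenvalues rfl, fun i => ?_⟩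
  have h := congrArg e (hT.apply_eigenvectorBasis rfl i)
  have h1 : ∀ x, e (T x) = X *ᵥ e x := fun x => by simp [T, M]
  rw [h1] at h
  rw [Basis.map_apply, OrthonormalBasis.coe_toBasis, h]
  exact map_smul e _ _

theorem eq_of_mulVec_basis {n : ℕ} (b : Basis (Fin n) ℝ (Fin p ⊕ Fin q → 𝔻)) {X Y : Mat 𝔻 p q}
    (h : ∀ i, X *ᵥ b i = Y *ᵥ b i) : X = Y := by
  let M (X : Mat 𝔻 p q) : (Fin p ⊕ Fin q → 𝔻) →ₗ[ℝ] (Fin p ⊕ Fin q → 𝔻) :=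
    { toFun := fun u => X *ᵥ u
      map_add' := Matrix.mulVec_add X
      map_smul' := fun r u => Matrix.mulVec_smul X r u }
  have hM : M X = M Y := b.ext h
  exact Matrix.mulVec_injective (funext fun u => LinearMap.congr_fun hM u)

theorem pow_mulVec {X : Mat 𝔻 p q} {u : Fin p ⊕ Fin q → 𝔻} {l : ℝ} (h : X *ᵥ u = l • u) (k : ℕ) :
    (X ^ k) *ᵥ u = l ^ k • u := by
  induction k with
  | zero => simp
  | succ k ih => rw [pow_succ, ← Matrix.mulVec_mulVec, h, Matrix.mulVec_smul, ih, smul_smul,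
      pow_succ']

theorem aeval_mulVec {X : Mat 𝔻 p q} {u : Fin p ⊕ Fin q → 𝔻} {l : ℝ} (h : X *ᵥ u = l • u)
    (f : Polynomial ℝ) : (Polynomial.aeval X f) *ᵥ u = f.eval l • u := by
  rw [Polynomial.aeval_eq_sum_range, Polynomial.eval_eq_sum_range, Matrix.sum_mulVec,
    Finset.sum_smul]
  refine Finset.sum_congr rfl fun k _ => ?_
  rw [Matrix.smul_mulVec, pow_mulVec h, smul_smul]

theorem isHermitian_aeval {X : Mat 𝔻 p q} (h : X.IsHermitian) (f : Polynomial ℝ) :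
    (Polynomial.aeval X f).IsHermitian := by
  rw [Polynomial.aeval_eq_sum_range, Matrix.IsHermitian, Matrix.conjTranspose_sum]
  refine Finset.sum_congr rfl fun k _ => ?_
  rw [Matrix.conjTranspose_smul, star_trivial, (h.pow k).eq]

instance : CompleteSpace (Mat 𝔻 p q) := FiniteDimensional.complete ℝ _

theorem exp_mulVec {X : Mat 𝔻 p q} {u : Fin p ⊕ Fin q → 𝔻} {l : ℝ} (h : X *ᵥ u = l • u) :
    NormedSpace.exp X *ᵥ u = Real.exp l • u := by
  let M : Mat 𝔻 p q →ₗ[ℝ] (Fin p ⊕ Fin q → 𝔻) :=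
    { toFun := fun X => X *ᵥ u
      map_add' := fun X Y => Matrix.add_mulVec X Y u
      map_smul' := fun r X => Matrix.smul_mulVec r X u }
  have h1 := (NormedSpace.exp_series_hasSum_exp' (𝕂 := ℝ) X).mapL
    (LinearMap.toContinuousLinearMap M)
  have h2 := (NormedSpace.exp_series_hasSum_exp' (𝕂 := ℝ) l).smul_const u
  rw [← Real.exp_eq_exp_ℝ] at h2
  have h3 : (fun n : ℕ => LinearMap.toContinuousLinearMap M ((n.factorial⁻¹ : ℝ) • X ^ n)) =
      fun n : ℕ => ((n.factorial⁻¹ : ℝ) • l ^ n) • u := by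
    funext n
    rw [map_smul, smul_assoc, ← pow_mulVec h]
    rfl
  rw [h3] at h1
  exact h1.unique h2

/-- Interpolation on a finite set of reals. -/
theorem exists_polynomial_eval_eq (s : Finset ℝ) (f : ℝ → ℝ) :
    ∃ P : Polynomial ℝ, ∀ x ∈ s, P.eval x = f x :=
  ⟨Lagrange.interpolate s id f, fun _ hx =>
    Lagrange.eval_interpolate_at_node f Function.injective_id.injOn hx⟩

theorem exp_injOn_isHermitian :
    Set.InjOn NormedSpace.exp {X : Mat 𝔻 p q | X.IsHermitian} := by
  intro X hX Y hY h
  obtain ⟨n, b, l, hl⟩ := exists_basis_eigenvectors hX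
  obtain ⟨m, c, k, hk⟩ := exists_basis_eigenvectors hY
  -- A single polynomial equals `log` on both spectra, so the same `P` recovers `X` from `exp X` and
  -- `Y` from `exp Y`.
  obtain ⟨P, hP⟩ := exists_polynomial_eval_eq
    (Finset.univ.image (fun i => Real.exp (l i)) ∪ Finset.univ.image fun i => Real.exp (k i))
    Real.log
  have h1 : Polynomial.aeval (NormedSpace.exp X) P = X := by
    refine eq_of_mulVec_basis b fun i => ?_
    rw [aeval_mulVec (exp_mulVec (hl i)), hl i, hP _ (by simp), Real.log_exp]
  have h2 : Polynomial.aeval (NormedSpace.exp Y) P = Y := by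
    refine eq_of_mulVec_basis c fun i => ?_
    rw [aeval_mulVec (exp_mulVec (hk i)), hk i, hP _ (by simp), Real.log_exp]
  rw [← h1, h, h2]

/-- On an eigenbasis `exp X` agrees with a real polynomial in `X`, and such polynomials are
Hermitian. -/
theorem isHermitian_exp {X : Mat 𝔻 p q} (hX : X.IsHermitian) :
    (NormedSpace.exp X).IsHermitian := by
  obtain ⟨n, b, l, hl⟩ := exists_basis_eigenvectors hX
  obtain ⟨P, hP⟩ := exists_polynomial_eval_eq (Finset.univ.image l) Real.exp
  have h1 : Polynomial.aeval X P = NormedSpace.exp X := by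
    refine eq_of_mulVec_basis b fun i => ?_
    rw [aeval_mulVec (hl i), exp_mulVec (hl i), hP _ (by simp)]
  exact h1 ▸ isHermitian_aeval hX P

theorem re_star_dotProduct_self (u : Fin p ⊕ Fin q → 𝔻) :
    RealPart.re (star u ⬝ᵥ u) = ∑ i, ‖u i‖ ^ 2 := by
  rw [dotProduct, re_sum]
  exact Finset.sum_congr rfl fun i _ => StarDivisionAlgebra.re_star_mul_self _

theorem re_star_dotProduct_self_pos {u : Fin p ⊕ Fin q → 𝔻} (hu : u ≠ 0) :
    0 < RealPart.re (star u ⬝ᵥ u) := by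
  rw [re_star_dotProduct_self]
  obtain ⟨i, hi⟩ := Function.ne_iff.mp hu
  have hi' : u i ≠ 0 := hi
  exact Finset.sum_pos' (fun _ _ => by positivity) ⟨i, Finset.mem_univ i, by positivity⟩

theorem isPositive_one : IsPositive (1 : Mat 𝔻 p q) :=
  ⟨Matrix.isHermitian_one, fun u hu => by
    rw [Matrix.one_mulVec]; exact re_star_dotProduct_self_pos hu⟩

theorem isHermitian_conj {S X : Mat 𝔻 p q} (hS : S.IsHermitian) (hX : X.IsHermitian) :
    (S * X * S).IsHermitian := by
  rw [Matrix.IsHermitian, Matrix.conjTranspose_mul, Matrix.conjTranspose_mul, hS.eq, hX.eq,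
    Matrix.mul_assoc]

theorem IsPositive.conj {S P : Mat 𝔻 p q} (hP : IsPositive P) (hS : S.IsHermitian)
    (hu : IsUnit S) : IsPositive (S * P * S) := by
  refine ⟨isHermitian_conj hS hP.1, fun u h0 => ?_⟩
  have h1 : S *ᵥ u ≠ 0 := by
    intro h
    obtain ⟨R, hR⟩ := hu.exists_left_inv
    apply h0
    rw [← Matrix.one_mulVec u, ← hR, ← Matrix.mulVec_mulVec, h, Matrix.mulVec_zero]
  have h2 := hP.2 _ h1
  rw [← Matrix.mulVec_mulVec, ← Matrix.mulVec_mulVec, Matrix.star_mulVec, hS.eq,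
    ← Matrix.dotProduct_mulVec]
  exact h2

/-- Positivity makes every eigenvalue positive, and a polynomial interpolating `log` on the spectrum
gives the logarithm. -/
theorem exists_isHermitian_exp_eq {P : Mat 𝔻 p q} (hP : IsPositive P) :
    ∃ X : Mat 𝔻 p q, X.IsHermitian ∧ NormedSpace.exp X = P := by
  obtain ⟨n, b, l, hl⟩ := exists_basis_eigenvectors hP.1
  obtain ⟨f, hf⟩ := exists_polynomial_eval_eq (Finset.univ.image l) Real.log
  refine ⟨Polynomial.aeval P f, isHermitian_aeval hP.1 f, eq_of_mulVec_basis b fun i => ?_⟩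
  have hpos : 0 < l i := by
    have h1 := hP.2 _ (b.ne_zero i)
    rw [hl i, star_smul, smul_dotProduct, StarDivisionAlgebra.re_smul, star_trivial] at h1
    exact pos_of_mul_pos_left h1 (re_star_dotProduct_self_pos (b.ne_zero i)).le
  rw [exp_mulVec (aeval_mulVec (hl i) f), hf _ (by simp), Real.exp_log hpos, hl i]

theorem exp_add_smul (X : Mat 𝔻 p q) (s t : ℝ) :
    NormedSpace.exp ((s + t) • X) = NormedSpace.exp (s • X) * NormedSpace.exp (t • X) := by
  let _ : NormedAlgebra ℚ (Mat 𝔻 p q) := NormedAlgebra.restrictScalars ℚ ℝ _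
  rw [add_smul]
  exact NormedSpace.exp_add_of_commute (((Commute.refl X).smul_left s).smul_right t)

theorem isUnit_exp (X : Mat 𝔻 p q) : IsUnit (NormedSpace.exp X) := by
  let _ : NormedAlgebra ℚ (Mat 𝔻 p q) := NormedAlgebra.restrictScalars ℚ ℝ _
  exact NormedSpace.isUnit_exp X

theorem exp_half_mul_self (X : Mat 𝔻 p q) :
    NormedSpace.exp ((1 / 2 : ℝ) • X) * NormedSpace.exp ((1 / 2 : ℝ) • X) =
      NormedSpace.exp X := by
  rw [← exp_add_smul, add_halves, one_smul]

theorem exp_mul_exp_neg (X : Mat 𝔻 p q) (t : ℝ) :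
    NormedSpace.exp (t • X) * NormedSpace.exp ((-t) • X) = 1 := by
  rw [← exp_add_smul, add_neg_cancel, zero_smul, NormedSpace.exp_zero]

theorem exp_neg_mul_exp (X : Mat 𝔻 p q) (t : ℝ) :
    NormedSpace.exp ((-t) • X) * NormedSpace.exp (t • X) = 1 := by
  rw [← exp_add_smul, neg_add_cancel, zero_smul, NormedSpace.exp_zero]

theorem isHermitian_smul {X : Mat 𝔻 p q} (hX : X.IsHermitian) (r : ℝ) : (r • X).IsHermitian := by
  rw [Matrix.IsHermitian, Matrix.conjTranspose_smul, star_trivial, hX.eq]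

/-- `exp X` is the congruence of the identity by the invertible Hermitian matrix `exp (X / 2)`. -/
theorem isPositive_exp {X : Mat 𝔻 p q} (hX : X.IsHermitian) :
    IsPositive (NormedSpace.exp X) := by
  have h := isPositive_one.conj (isHermitian_exp (isHermitian_smul hX (1 / 2)))
    (isUnit_exp ((1 / 2 : ℝ) • X))
  rwa [Matrix.mul_one, exp_half_mul_self] at h

theorem IsPositive.isUnit {P : Mat 𝔻 p q} (hP : IsPositive P) : IsUnit P := by
  obtain ⟨X, -, rfl⟩ := exists_isHermitian_exp_eq hP
  exact isUnit_exp X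

/-- A positive matrix has an invertible Hermitian square root. -/
theorem IsPositive.exists_sqrt {P : Mat 𝔻 p q} (hP : IsPositive P) :
    ∃ S R : Mat 𝔻 p q, S.IsHermitian ∧ R.IsHermitian ∧ S * R = 1 ∧ R * S = 1 ∧ S * S = P := by
  obtain ⟨X, hX, rfl⟩ := exists_isHermitian_exp_eq hP
  exact ⟨_, _, isHermitian_exp (isHermitian_smul hX (1 / 2)),
    isHermitian_exp (isHermitian_smul hX (-(1 / 2))), exp_mul_exp_neg X _, exp_neg_mul_exp X _,
    exp_half_mul_self X⟩

/-! ### Transfer between `J`-Hermitian and Hermitian matrices. -/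

theorem sgn_mul_sgn : sgn 𝔻 p q * sgn 𝔻 p q = 1 := by
  simp [sgn, Matrix.fromBlocks_multiply]

theorem sgn_mul_sgn_mul (X : Mat 𝔻 p q) : sgn 𝔻 p q * (sgn 𝔻 p q * X) = X := by
  rw [← Matrix.mul_assoc, sgn_mul_sgn, Matrix.one_mul]

theorem isHermitian_sgn : (sgn 𝔻 p q).IsHermitian := by
  simp [sgn, Matrix.IsHermitian, Matrix.fromBlocks_conjTranspose]

theorem mem_jHermitian_iff {X : Mat 𝔻 p q} :
    X ∈ jHermitian 𝔻 p q ↔ (sgn 𝔻 p q * X).IsHermitian := by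
  rw [Matrix.IsHermitian, Matrix.conjTranspose_mul, isHermitian_sgn.eq]
  change sgn 𝔻 p q * Xᴴ * sgn 𝔻 p q = X ↔ _
  constructor
  · intro h
    conv_rhs => rw [← h]
    rw [Matrix.mul_assoc (sgn 𝔻 p q), sgn_mul_sgn_mul]
  · intro h
    rw [Matrix.mul_assoc, h, sgn_mul_sgn_mul]

theorem mem_jPositive_iff {X : Mat 𝔻 p q} :
    X ∈ jPositive 𝔻 p q ↔ IsPositive (sgn 𝔻 p q * X) :=
  ⟨fun h => h.2, fun h => ⟨mem_jHermitian_iff.mpr h.1, h⟩⟩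

theorem jPositive_subset : jPositive 𝔻 p q ⊆ jHermitian 𝔻 p q := fun _ h => h.1

theorem bijOn_jExp : Set.BijOn jExp (jHermitian 𝔻 p q : Set (Mat 𝔻 p q)) (jPositive 𝔻 p q) := by
  refine ⟨fun X hX => ?_, fun X hX Y hY h => ?_, fun X hX => ?_⟩
  · rw [mem_jPositive_iff, jExp, sgn_mul_sgn_mul]
    exact isPositive_exp (mem_jHermitian_iff.mp hX)
  · have h1 := congrArg (sgn 𝔻 p q * ·) h
    simp only [jExp, sgn_mul_sgn_mul] at h1
    have h2 := exp_injOn_isHermitian (mem_jHermitian_iff.mp hX) (mem_jHermitian_iff.mp hY) h1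
    rw [← sgn_mul_sgn_mul X, h2, sgn_mul_sgn_mul]
  · obtain ⟨Y, hY, h⟩ := exists_isHermitian_exp_eq (mem_jPositive_iff.mp hX)
    refine ⟨sgn 𝔻 p q * Y, mem_jHermitian_iff.mpr (by rwa [sgn_mul_sgn_mul]), ?_⟩
    rw [jExp, sgn_mul_sgn_mul, h, sgn_mul_sgn_mul]

/-! ### The trace metric -/

/-- The reduced trace as a continuous linear functional. -/
def redTraceL (𝔻 : Type) [NormedDivisionRing 𝔻] [StarRing 𝔻] [NormedAlgebra ℝ 𝔻]
    [RealPart 𝔻] [StarDivisionAlgebra 𝔻] (p q : ℕ) : Mat 𝔻 p q →L[ℝ] ℝ :=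
  LinearMap.toContinuousLinearMap (reL 𝔻 ∘ₗ Matrix.traceLinearMap (Fin p ⊕ Fin q) ℝ 𝔻)

theorem redTraceL_apply (X : Mat 𝔻 p q) : redTraceL 𝔻 p q X = redTrace X := rfl

theorem redTrace_neg_add_neg (X Y : Mat 𝔻 p q) :
    redTrace (-X + -Y) = -(redTrace X + redTrace Y) := by
  simp only [← redTraceL_apply, map_add, map_neg, neg_add]

/-- Over the quaternions the trace itself is not cyclic; its real part is, because `Re (ab) = Re
(ba)`. -/
theorem redTrace_mul_comm (X Y : Mat 𝔻 p q) : redTrace (X * Y) = redTrace (Y * X) := by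
  simp only [redTrace, Matrix.trace, Matrix.diag_apply, Matrix.mul_apply, re_sum]
  rw [Finset.sum_comm]
  simp only [StarDivisionAlgebra.re_mul_comm]

theorem redTrace_conjTranspose_mul_self_pos {X : Mat 𝔻 p q} (hX : X ≠ 0) :
    0 < redTrace (Xᴴ * X) := by
  have h : redTrace (Xᴴ * X) = ∑ j, ∑ i, ‖X i j‖ ^ 2 := by
    simp only [redTrace, Matrix.trace, Matrix.diag_apply, Matrix.mul_apply, re_sum,
      Matrix.conjTranspose_apply, StarDivisionAlgebra.re_star_mul_self]
  have : ∃ j i, X i j ≠ 0 := by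
    by_contra! h0
    exact hX (Matrix.ext fun i j => h0 j i)
  obtain ⟨j, i, hij⟩ := this
  rw [h]
  refine Finset.sum_pos' (fun _ _ => by positivity) ⟨j, Finset.mem_univ j, ?_⟩
  exact Finset.sum_pos' (fun _ _ => by positivity) ⟨i, Finset.mem_univ i, by positivity⟩

theorem traceMetric_symm (P U V : Mat 𝔻 p q) : traceMetric P U V = traceMetric P V U := by
  rw [traceMetric, Matrix.mul_assoc, redTrace_mul_comm, ← Matrix.mul_assoc]
  rfl

theorem ringInverse_eq {P R : Mat 𝔻 p q} (h : P * R = 1) (h' : R * P = 1) :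
    Ring.inverse P = R :=
  Ring.inverse_unit (⟨P, R, h, h'⟩ : (Mat 𝔻 p q)ˣ)

/-- With `P = S²` and `R = S⁻¹`, cyclicity rewrites the value as the squared Frobenius norm of the
Hermitian matrix `R U R`. -/
theorem traceMetric_pos {P U : Mat 𝔻 p q} (hP : IsPositive P) (hU : U.IsHermitian) (h0 : U ≠ 0) :
    0 < traceMetric P U U := by
  obtain ⟨S, R, hS, hR, hSR, hRS, rfl⟩ := hP.exists_sqrt
  have hinv : Ring.inverse (S * S) = R * R :=
    ringInverse_eq (by rw [Matrix.mul_assoc, ← Matrix.mul_assoc S R, hSR, Matrix.one_mul, hSR])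
      (by rw [Matrix.mul_assoc, ← Matrix.mul_assoc R S, hRS, Matrix.one_mul, hRS])
  have hne : R * U * R ≠ 0 := by
    intro h
    apply h0
    calc U = (S * R) * U * (R * S) := by rw [hSR, hRS, Matrix.one_mul, Matrix.mul_one]
      _ = S * (R * U * R) * S := by simp only [Matrix.mul_assoc]
      _ = 0 := by rw [h, Matrix.mul_zero, Matrix.zero_mul]
  have h := redTrace_conjTranspose_mul_self_pos hne
  rw [(isHermitian_conj hR hU).eq] at h
  have h2 : redTrace (R * U * R * (R * U * R)) = redTrace (R * (U * R * (R * U * R))) := by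
    simp only [Matrix.mul_assoc]
  rw [h2, redTrace_mul_comm] at h
  rw [traceMetric, hinv, redTrace_mul_comm]
  simpa only [Matrix.mul_assoc] using h

/-! ### The metric on the cone -/

theorem continuousStar_scalar : ContinuousStar 𝔻 :=
  ⟨(starLinearEquiv ℝ (A := 𝔻)).toLinearMap.continuous_of_finiteDimensional⟩

theorem continuous_re : Continuous (RealPart.re : 𝔻 → ℝ) :=
  (reL 𝔻).continuous_of_finiteDimensional

theorem re_star_mulVec_smul (X : Mat 𝔻 p q) (r : ℝ) (u : Fin p ⊕ Fin q → 𝔻) :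
    RealPart.re (star (X *ᵥ (r • u)) ⬝ᵥ (r • u)) =
      r * (r * RealPart.re (star (X *ᵥ u) ⬝ᵥ u)) := by
  rw [Matrix.mulVec_smul, star_smul, star_trivial, smul_dotProduct, dotProduct_smul,
    StarDivisionAlgebra.re_smul, StarDivisionAlgebra.re_smul]

/-- Positivity need only be tested on the unit sphere, by homogeneity of degree two. The sphere is
compact, so strict positivity there persists in a neighbourhood. -/
theorem isOpen_jPositive :
    IsOpen {x : jHermitian 𝔻 p q | (x : Mat 𝔻 p q) ∈ jPositive 𝔻 p q} := by
  have : ProperSpace (Fin p ⊕ Fin q → 𝔻) := FiniteDimensional.proper ℝ _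
  have : ContinuousStar 𝔻 := continuousStar_scalar
  rw [isOpen_iff_eventually]
  intro x hx
  have hc : Continuous fun z : jHermitian 𝔻 p q × (Fin p ⊕ Fin q → 𝔻) =>
      RealPart.re (star ((sgn 𝔻 p q * (z.1 : Mat 𝔻 p q)) *ᵥ z.2) ⬝ᵥ z.2) := by
    refine continuous_re.comp (Continuous.dotProduct (Continuous.star ?_) continuous_snd)
    exact Continuous.matrix_mulVec
      (continuous_const.mul (continuous_subtype_val.comp continuous_fst)) continuous_snd
  have key := (isCompact_sphere (0 : Fin p ⊕ Fin q → 𝔻) 1).eventually_forall_of_forall_eventually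
    (x₀ := x) (P := fun (y : jHermitian 𝔻 p q) u =>
      0 < RealPart.re (star ((sgn 𝔻 p q * (y : Mat 𝔻 p q)) *ᵥ u) ⬝ᵥ u)) (by
      intro u hu
      refine (isOpen_lt continuous_const hc).mem_nhds (x := (x, u)) ?_
      have hu0 : u ≠ 0 := by rintro rfl; simp at hu
      exact hx.2.2 u hu0)
  filter_upwards [key] with y hy
  refine ⟨y.2, mem_jHermitian_iff.mp y.2, fun u hu => ?_⟩
  have hu' : 0 < ‖u‖ := norm_pos_iff.mpr hu
  have h1 := hy (‖u‖⁻¹ • u) (by simp [norm_smul, hu'.ne'])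
  rw [re_star_mulVec_smul] at h1
  exact pos_of_mul_pos_right (pos_of_mul_pos_right h1 (by positivity)) (by positivity)

theorem contDiffAt_jMetric {P : Mat 𝔻 p q} (hP : IsUnit (sgn 𝔻 p q * P)) (U V : Mat 𝔻 p q) :
    ContDiffAt ℝ ∞ (fun P => jMetric P U V) P := by
  obtain ⟨x, hx⟩ := hP
  have h1 : ContDiffAt ℝ ∞ (fun P : Mat 𝔻 p q => Ring.inverse (sgn 𝔻 p q * P)) P := by
    refine ContDiffAt.comp P (g := Ring.inverse) ?_ (contDiffAt_const.mul contDiffAt_id)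
    rw [← hx]
    exact contDiffAt_ringInverse ℝ x
  exact (redTraceL 𝔻 p q).contDiff.contDiffAt.comp P
    (((h1.mul contDiffAt_const).mul h1).mul contDiffAt_const)

theorem isRiemannianMetric_jMetric :
    FlatChart.IsRiemannianMetric (jHermitian 𝔻 p q) (jPositive 𝔻 p q) jMetric where
  subset := jPositive_subset
  isOpen := isOpen_jPositive
  add_left P _ U _ V _ W _ := by
    simp only [jMetric, traceMetric, Matrix.mul_add, Matrix.add_mul, ← redTraceL_apply, map_add]
  smul_left P _ a U _ V _ := by
    simp only [jMetric, traceMetric, Matrix.mul_smul, Matrix.smul_mul, ← redTraceL_apply,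
      map_smul, smul_eq_mul]
  symm P _ U _ V _ := traceMetric_symm _ _ _
  pos P hP U hU h0 := traceMetric_pos hP.2 (mem_jHermitian_iff.mp hU) fun h => h0 <| by
    rw [← sgn_mul_sgn_mul U, h, Matrix.mul_zero]
  smooth U _ V _ P hP :=
    (contDiffAt_jMetric hP.2.isUnit U V).contDiffWithinAt

/-! ### The Christoffel symbols -/

theorem hasDerivAt_ringInverse_add_smul {P : Mat 𝔻 p q} (hP : IsUnit P) (U : Mat 𝔻 p q) :
    HasDerivAt (fun t : ℝ => Ring.inverse (P + t • U))
      (-(Ring.inverse P * U * Ring.inverse P)) 0 := by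
  obtain ⟨x, rfl⟩ := hP
  have h1 : HasDerivAt (fun t : ℝ => (x : Mat 𝔻 p q) + t • U) U 0 := by
    exact (((hasDerivAt_id (0 : ℝ)).smul_const U).const_add (x : Mat 𝔻 p q)).congr_deriv
      (one_smul ℝ U)
  have h2 := hasFDerivAt_ringInverse (𝕜 := ℝ) x
  have h3 : (x : Mat 𝔻 p q) = x + (0 : ℝ) • U := by simp
  rw [h3] at h2
  rw [Ring.inverse_unit]
  exact h2.comp_hasDerivAt (0 : ℝ) h1

theorem lineDeriv_jMetric {P : Mat 𝔻 p q} (hP : IsUnit (sgn 𝔻 p q * P)) (U V W : Mat 𝔻 p q) :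
    lineDeriv ℝ (fun X => jMetric X V W) P U =
      -(redTrace (Ring.inverse (sgn 𝔻 p q * P) * (sgn 𝔻 p q * U) *
          Ring.inverse (sgn 𝔻 p q * P) * (sgn 𝔻 p q * V) *
          Ring.inverse (sgn 𝔻 p q * P) * (sgn 𝔻 p q * W)) +
        redTrace (Ring.inverse (sgn 𝔻 p q * P) * (sgn 𝔻 p q * V) *
          Ring.inverse (sgn 𝔻 p q * P) * (sgn 𝔻 p q * U) *
          Ring.inverse (sgn 𝔻 p q * P) * (sgn 𝔻 p q * W))) := by
  have h1 := hasDerivAt_ringInverse_add_smul hP (sgn 𝔻 p q * U)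
  have h2 := (redTraceL 𝔻 p q).hasFDerivAt.comp_hasDerivAt (0 : ℝ)
    (((h1.mul_const (sgn 𝔻 p q * V)).mul h1).mul_const (sgn 𝔻 p q * W))
  rw [zero_smul, add_zero] at h2
  have h3 : (fun t : ℝ => jMetric (P + t • U) V W) = redTraceL 𝔻 p q ∘ fun t : ℝ =>
      Ring.inverse (sgn 𝔻 p q * P + t • (sgn 𝔻 p q * U)) * (sgn 𝔻 p q * V) *
        Ring.inverse (sgn 𝔻 p q * P + t • (sgn 𝔻 p q * U)) * (sgn 𝔻 p q * W) := by
    funext t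
    simp only [jMetric, traceMetric, Matrix.mul_add, Matrix.mul_smul]
    rfl
  rw [lineDeriv, h3]
  refine h2.deriv.trans ?_
  simp only [neg_mul, mul_neg, add_mul, mul_assoc]
  exact redTrace_neg_add_neg _ _

/-- Let `T` be the trace with factors in the order `U`, `U`, `W`. Each of the three Koszul
derivatives equals `-2T` by cyclicity, so their combination is `-T`, that is, `Γ_P(U, U) = -U (J
P)⁻¹ J U`. -/
theorem jMetric_add_christoffel {P : Mat 𝔻 p q} (hP : IsUnit (sgn 𝔻 p q * P))
    (Z U W : Mat 𝔻 p q) :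
    jMetric P Z W + FlatChart.christoffel jMetric P U U W =
      jMetric P (Z - U * Ring.inverse (sgn 𝔻 p q * P) * (sgn 𝔻 p q * U)) W := by
  rw [FlatChart.christoffel, lineDeriv_jMetric hP, lineDeriv_jMetric hP]
  have h : redTrace (Ring.inverse (sgn 𝔻 p q * P) * (sgn 𝔻 p q * W) *
      Ring.inverse (sgn 𝔻 p q * P) * (sgn 𝔻 p q * U) *
      Ring.inverse (sgn 𝔻 p q * P) * (sgn 𝔻 p q * U)) =
      redTrace (Ring.inverse (sgn 𝔻 p q * P) * (sgn 𝔻 p q * U) *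
      Ring.inverse (sgn 𝔻 p q * P) * (sgn 𝔻 p q * U) *
      Ring.inverse (sgn 𝔻 p q * P) * (sgn 𝔻 p q * W)) := by
    have h1 := redTrace_mul_comm (Ring.inverse (sgn 𝔻 p q * P) * (sgn 𝔻 p q * W))
      (Ring.inverse (sgn 𝔻 p q * P) * (sgn 𝔻 p q * U) *
      (Ring.inverse (sgn 𝔻 p q * P) * (sgn 𝔻 p q * U)))
    simpa only [Matrix.mul_assoc] using h1
  have h' : redTrace (Ring.inverse (sgn 𝔻 p q * P) * (sgn 𝔻 p q * U) *
      Ring.inverse (sgn 𝔻 p q * P) * (sgn 𝔻 p q * W) *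
      Ring.inverse (sgn 𝔻 p q * P) * (sgn 𝔻 p q * U)) =
      redTrace (Ring.inverse (sgn 𝔻 p q * P) * (sgn 𝔻 p q * U) *
      Ring.inverse (sgn 𝔻 p q * P) * (sgn 𝔻 p q * U) *
      Ring.inverse (sgn 𝔻 p q * P) * (sgn 𝔻 p q * W)) := by
    have h1 := redTrace_mul_comm (Ring.inverse (sgn 𝔻 p q * P) * (sgn 𝔻 p q * U) *
      (Ring.inverse (sgn 𝔻 p q * P) * (sgn 𝔻 p q * W)))
      (Ring.inverse (sgn 𝔻 p q * P) * (sgn 𝔻 p q * U))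
    simpa only [Matrix.mul_assoc] using h1
  rw [h, h']
  simp only [jMetric, traceMetric, Matrix.mul_sub, Matrix.sub_mul, ← redTraceL_apply, map_sub,
    Matrix.mul_assoc]
  ring

/-! ### The curve -/

theorem jLog_mem {X : Mat 𝔻 p q} (hX : X ∈ jPositive 𝔻 p q) : jLog X ∈ jHermitian 𝔻 p q :=
  Function.invFunOn_mem (bijOn_jExp.surjOn hX)

theorem jExp_jLog {X : Mat 𝔻 p q} (hX : X ∈ jPositive 𝔻 p q) : jExp (jLog X) = X :=
  Function.invFunOn_eq (bijOn_jExp.surjOn hX)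

/-- In terms of Hermitian matrices, the `J`-power is the matrix power. -/
theorem exists_sgn_mul_jPow {X : Mat 𝔻 p q} (hX : X ∈ jPositive 𝔻 p q) :
    ∃ L : Mat 𝔻 p q, L.IsHermitian ∧ NormedSpace.exp L = sgn 𝔻 p q * X ∧
      ∀ t : ℝ, jPow X t = sgn 𝔻 p q * NormedSpace.exp (t • L) := by
  refine ⟨sgn 𝔻 p q * jLog X, mem_jHermitian_iff.mp (jLog_mem hX), ?_, fun t => ?_⟩
  · conv_rhs => rw [← jExp_jLog hX, jExp, sgn_mul_sgn_mul]
  · rw [jPow, jExp, Matrix.mul_smul]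

/-- Here `S` and `R` are `(J A)^{1/2}` and its inverse. Since `J² = 1`, every `J` except the leading
one cancels, leaving the classical formula. -/
theorem exists_jCurve_eq {A B : Mat 𝔻 p q} (hA : A ∈ jPositive 𝔻 p q)
    (hB : B ∈ jPositive 𝔻 p q) :
    ∃ S R L : Mat 𝔻 p q, S.IsHermitian ∧ R.IsHermitian ∧ S * R = 1 ∧ R * S = 1 ∧
      S * S = sgn 𝔻 p q * A ∧ L.IsHermitian ∧ NormedSpace.exp L = R * (sgn 𝔻 p q * B) * R ∧
      ∀ t, jCurve A B t = sgn 𝔻 p q * (S * NormedSpace.exp (t • L) * S) := by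
  obtain ⟨M, hM, hMA, hpow⟩ := exists_sgn_mul_jPow hA
  have hR := isHermitian_exp (isHermitian_smul hM (-(1 / 2)))
  have hC : jMul (jMul (jPow A (-(1 / 2))) B) (jPow A (-(1 / 2))) =
      sgn 𝔻 p q * (NormedSpace.exp ((-(1 / 2) : ℝ) • M) * (sgn 𝔻 p q * B) *
        NormedSpace.exp ((-(1 / 2) : ℝ) • M)) := by
    simp only [jMul, hpow, Matrix.mul_assoc, sgn_mul_sgn_mul]
  have hC' : jMul (jMul (jPow A (-(1 / 2))) B) (jPow A (-(1 / 2))) ∈ jPositive 𝔻 p q := by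
    rw [mem_jPositive_iff, hC, sgn_mul_sgn_mul]
    exact hB.2.conj hR (isUnit_exp _)
  obtain ⟨L, hL, hLC, hpow'⟩ := exists_sgn_mul_jPow hC'
  refine ⟨_, _, L, isHermitian_exp (isHermitian_smul hM (1 / 2)), hR, exp_mul_exp_neg M _,
    exp_neg_mul_exp M _, (exp_half_mul_self M).trans hMA, hL, ?_, fun t => ?_⟩
  · rw [hLC, hC, sgn_mul_sgn_mul]
  · rw [jCurve, hpow', hpow]
    simp only [jMul, Matrix.mul_assoc, sgn_mul_sgn_mul]

/-! ### Existence -/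

/-- Multiplication by fixed matrices on both sides as a continuous linear map. -/
def mulLR (X Y : Mat 𝔻 p q) : Mat 𝔻 p q →L[ℝ] Mat 𝔻 p q :=
  ContinuousLinearMap.mulLeftRight ℝ (Mat 𝔻 p q) X Y

theorem mulLR_apply (X Y Z : Mat 𝔻 p q) : mulLR X Y Z = X * Z * Y := rfl

theorem hasDerivAt_mulLR_exp (X Y L : Mat 𝔻 p q) (t : ℝ) :
    HasDerivAt (fun t : ℝ => mulLR X Y (NormedSpace.exp (t • L)))
      (mulLR X Y (NormedSpace.exp (t • L) * L)) t :=
  (mulLR X Y).hasFDerivAt.comp_hasDerivAt t (hasDerivAt_exp_smul_const L t)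

theorem contDiff_mulLR_exp (X Y L : Mat 𝔻 p q) :
    ContDiff ℝ ∞ fun t : ℝ => mulLR X Y (NormedSpace.exp (t • L)) := by
  refine (mulLR X Y).contDiff.comp ?_
  have h : ContDiff ℝ ∞ (NormedSpace.exp : Mat 𝔻 p q → Mat 𝔻 p q) :=
    contDiff_iff_contDiffAt.mpr fun x => (NormedSpace.exp_analytic (𝕂 := ℝ) x).contDiffAt
  exact h.comp (contDiff_id.smul contDiff_const)

theorem iteratedDerivWithin_two_eq {E : Type*} [NormedAddCommGroup E] [NormedSpace ℝ E]
    {s : Set ℝ} (f : ℝ → E) :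
    iteratedDerivWithin 2 f s = derivWithin (derivWithin f s) s := by
  rw [iteratedDerivWithin_succ, iteratedDerivWithin_one]

theorem isGeodesicFromTo_jCurve {A B : Mat 𝔻 p q} (hA : A ∈ jPositive 𝔻 p q)
    (hB : B ∈ jPositive 𝔻 p q) :
    FlatChart.IsGeodesicFromTo (jHermitian 𝔻 p q) (jPositive 𝔻 p q) jMetric A B
      (jCurve A B) := by
  obtain ⟨S, R, L, hS, hR, hSR, hRS, hSA, hL, hLB, hγ⟩ := exists_jCurve_eq hA hB
  have hfun : jCurve A B = fun t : ℝ => mulLR (sgn 𝔻 p q * S) S (NormedSpace.exp (t • L)) := by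
    funext t
    rw [hγ, mulLR_apply]
    simp only [Matrix.mul_assoc]
  have hmem : ∀ t, jCurve A B t ∈ jPositive 𝔻 p q := fun t => by
    rw [mem_jPositive_iff, hγ, sgn_mul_sgn_mul]
    exact (isPositive_exp (isHermitian_smul hL t)).conj hS ⟨⟨S, R, hSR, hRS⟩, rfl⟩
  have hI : UniqueDiffOn ℝ (Set.Icc (0 : ℝ) 1) := uniqueDiffOn_Icc one_pos
  have hd1 : ∀ t ∈ Set.Icc (0 : ℝ) 1, derivWithin (jCurve A B) (Set.Icc 0 1) t =
      mulLR (sgn 𝔻 p q * S) S (NormedSpace.exp (t • L) * L) := fun t ht => by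
    rw [hfun]
    exact (hasDerivAt_mulLR_exp _ _ L t).hasDerivWithinAt.derivWithin (hI t ht)
  have hd2 : ∀ t ∈ Set.Icc (0 : ℝ) 1, iteratedDerivWithin 2 (jCurve A B) (Set.Icc 0 1) t =
      mulLR (sgn 𝔻 p q * S) (L * S) (NormedSpace.exp (t • L) * L) := fun t ht => by
    -- The factor `L` of the first derivative is moved into the fixed right multiplier, so the same
    -- derivative formula applies again.
    rw [iteratedDerivWithin_two_eq, derivWithin_congr (f := fun t : ℝ =>
      mulLR (sgn 𝔻 p q * S) (L * S) (NormedSpace.exp (t • L))) ?_ ?_]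
    · exact (hasDerivAt_mulLR_exp _ _ L t).hasDerivWithinAt.derivWithin (hI t ht)
    · intro x hx
      refine (hd1 x hx).trans ?_
      simp only [mulLR_apply, Matrix.mul_assoc]
    · refine (hd1 t ht).trans ?_
      simp only [mulLR_apply, Matrix.mul_assoc]
  refine ⟨fun t _ => hmem t, ?_, ?_, ?_, fun t ht W hW => ?_⟩
  · rw [hfun]
    exact (contDiff_mulLR_exp _ _ L).contDiffOn
  · rw [hγ, zero_smul, NormedSpace.exp_zero, Matrix.mul_one, hSA, sgn_mul_sgn_mul]
  · rw [hγ, one_smul, hLB]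
    calc sgn 𝔻 p q * (S * (R * (sgn 𝔻 p q * B) * R) * S)
        = sgn 𝔻 p q * ((S * R) * (sgn 𝔻 p q * B) * (R * S)) := by simp only [Matrix.mul_assoc]
      _ = B := by rw [hSR, hRS, Matrix.one_mul, Matrix.mul_one, sgn_mul_sgn_mul]
  · have hinv : Ring.inverse (sgn 𝔻 p q * jCurve A B t) =
        R * NormedSpace.exp ((-t) • L) * R := by
      rw [hγ, sgn_mul_sgn_mul]
      refine ringInverse_eq ?_ ?_
      · calc S * NormedSpace.exp (t • L) * S * (R * NormedSpace.exp ((-t) • L) * R)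
            = S * (NormedSpace.exp (t • L) * (S * R) * NormedSpace.exp ((-t) • L)) * R := by
              simp only [Matrix.mul_assoc]
          _ = 1 := by rw [hSR, Matrix.mul_one, exp_mul_exp_neg, Matrix.mul_one, hSR]
      · calc R * NormedSpace.exp ((-t) • L) * R * (S * NormedSpace.exp (t • L) * S)
            = R * (NormedSpace.exp ((-t) • L) * (R * S) * NormedSpace.exp (t • L)) * S := by
              simp only [Matrix.mul_assoc]
          _ = 1 := by rw [hRS, Matrix.mul_one, exp_neg_mul_exp, Matrix.mul_one, hRS]
    have hz : mulLR (sgn 𝔻 p q * S) (L * S) (NormedSpace.exp (t • L) * L) -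
        mulLR (sgn 𝔻 p q * S) S (NormedSpace.exp (t • L) * L) *
          Ring.inverse (sgn 𝔻 p q * jCurve A B t) *
          (sgn 𝔻 p q * mulLR (sgn 𝔻 p q * S) S (NormedSpace.exp (t • L) * L)) = 0 := by
      rw [sub_eq_zero, hinv]
      simp only [mulLR_apply]
      symm
      calc sgn 𝔻 p q * S * (NormedSpace.exp (t • L) * L) * S *
            (R * NormedSpace.exp ((-t) • L) * R) *
            (sgn 𝔻 p q * (sgn 𝔻 p q * S * (NormedSpace.exp (t • L) * L) * S))
          = sgn 𝔻 p q * S * (NormedSpace.exp (t • L) * L) * ((S * R) *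
            NormedSpace.exp ((-t) • L) * (R * S)) * (NormedSpace.exp (t • L) * L) * S := by
            simp only [Matrix.mul_assoc, sgn_mul_sgn_mul]
        _ = sgn 𝔻 p q * S * (NormedSpace.exp (t • L) * L) *
            (NormedSpace.exp ((-t) • L) * NormedSpace.exp (t • L)) * (L * S) := by
            rw [hSR, hRS, Matrix.one_mul, Matrix.mul_one]
            simp only [Matrix.mul_assoc]
        _ = sgn 𝔻 p q * S * (NormedSpace.exp (t • L) * L) * (L * S) := by
            rw [exp_neg_mul_exp, Matrix.mul_one]
    have key : ∀ Z U, Z = mulLR (sgn 𝔻 p q * S) (L * S) (NormedSpace.exp (t • L) * L) →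
        U = mulLR (sgn 𝔻 p q * S) S (NormedSpace.exp (t • L) * L) →
        jMetric (jCurve A B t) Z W + FlatChart.christoffel jMetric (jCurve A B t) U U W = 0 := by
      rintro Z U rfl rfl
      rw [jMetric_add_christoffel (hmem t).2.isUnit, hz]
      simp only [jMetric, traceMetric, Matrix.mul_zero, Matrix.zero_mul, ← redTraceL_apply,
        map_zero]
    exact key _ _ (hd2 t ht) (hd1 t ht)

/-! ### Uniqueness -/

/-- The linear map that vanishes exactly on the `J`-Hermitian matrices. -/
def jSkew (𝔻 : Type) [NormedDivisionRing 𝔻] [StarRing 𝔻] [NormedAlgebra ℝ 𝔻]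
    [StarModule ℝ 𝔻] [RealPart 𝔻] [StarDivisionAlgebra 𝔻] (p q : ℕ) :
    Mat 𝔻 p q →L[ℝ] Mat 𝔻 p q :=
  LinearMap.toContinuousLinearMap
    { toFun := fun X => sgn 𝔻 p q * Xᴴ * sgn 𝔻 p q - X
      map_add' := fun X Y => by
        rw [Matrix.conjTranspose_add, Matrix.mul_add, Matrix.add_mul]; abel
      map_smul' := fun r X => by
        rw [Matrix.conjTranspose_smul, star_trivial, Matrix.mul_smul, Matrix.smul_mul,
          RingHom.id_apply, smul_sub] }

theorem jSkew_eq_zero_iff {X : Mat 𝔻 p q} : jSkew 𝔻 p q X = 0 ↔ X ∈ jHermitian 𝔻 p q :=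
  sub_eq_zero (a := sgn 𝔻 p q * Xᴴ * sgn 𝔻 p q)

/-- The `J`-Hermitian matrices form the kernel of a continuous linear map, so velocities and
accelerations of curves in them stay there. -/
theorem mem_jHermitian_of_hasDerivWithinAt {f : ℝ → Mat 𝔻 p q} {f' : Mat 𝔻 p q} {s : Set ℝ}
    {t : ℝ} (h : HasDerivWithinAt f f' s t) (hs : UniqueDiffWithinAt ℝ s t)
    (hmem : ∀ x ∈ s, f x ∈ jHermitian 𝔻 p q) (ht : t ∈ s) : f' ∈ jHermitian 𝔻 p q := by
  rw [← jSkew_eq_zero_iff]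
  have h1 : HasDerivWithinAt (jSkew 𝔻 p q ∘ f) (jSkew 𝔻 p q f') s t :=
    (jSkew 𝔻 p q).hasFDerivAt.comp_hasDerivWithinAt t h
  have h2 : HasDerivWithinAt (jSkew 𝔻 p q ∘ f) 0 s t :=
    (hasDerivWithinAt_const t s (0 : Mat 𝔻 p q)).congr
      (fun x hx => jSkew_eq_zero_iff.mpr (hmem x hx)) (jSkew_eq_zero_iff.mpr (hmem t ht))
  exact (h1.derivWithin hs).symm.trans (h2.derivWithin hs)

theorem eq_of_hasDerivWithinAt_zero {E : Type*} [NormedAddCommGroup E] [NormedSpace ℝ E]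
    {f : ℝ → E} (h : ∀ t ∈ Set.Icc (0 : ℝ) 1, HasDerivWithinAt f 0 (Set.Icc 0 1) t) :
    ∀ t ∈ Set.Icc (0 : ℝ) 1, f t = f 0 :=
  constant_of_derivWithin_zero (fun t ht => (h t ht).differentiableWithinAt) fun t ht =>
    (h t (Set.Ico_subset_Icc_self ht)).derivWithin
      (uniqueDiffOn_Icc one_pos t (Set.Ico_subset_Icc_self ht))

/-- The geodesic equation says `γ'' = γ' (J γ)⁻¹ J γ'`. -/
theorem eq_of_geodesic_equation {P U Z : Mat 𝔻 p q} (hP : P ∈ jPositive 𝔻 p q)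
    (hU : U ∈ jHermitian 𝔻 p q) (hZ : Z ∈ jHermitian 𝔻 p q)
    (h : ∀ W ∈ jHermitian 𝔻 p q, jMetric P Z W + FlatChart.christoffel jMetric P U U W = 0) :
    Z = U * Ring.inverse (sgn 𝔻 p q * P) * (sgn 𝔻 p q * U) := by
  rw [← sub_eq_zero]
  by_contra h0
  have hinv : (Ring.inverse (sgn 𝔻 p q * P)).IsHermitian := by
    obtain ⟨S, R, hS, hR, hSR, hRS, hSP⟩ := hP.2.exists_sqrt
    rw [← hSP, ringInverse_eq (R := R * R)
      (by rw [Matrix.mul_assoc, ← Matrix.mul_assoc S R, hSR, Matrix.one_mul, hSR])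
      (by rw [Matrix.mul_assoc, ← Matrix.mul_assoc R S, hRS, Matrix.one_mul, hRS]),
      Matrix.IsHermitian, Matrix.conjTranspose_mul, hR.eq]
  -- The difference is itself an admissible test vector `W`, since `J U (J P)⁻¹ J U` is Hermitian.
  -- Positive definiteness then excludes a nonzero difference.
  have hD : Z - U * Ring.inverse (sgn 𝔻 p q * P) * (sgn 𝔻 p q * U) ∈ jHermitian 𝔻 p q := by
    refine Submodule.sub_mem _ hZ (mem_jHermitian_iff.mpr ?_)
    have h1 := isHermitian_conj (mem_jHermitian_iff.mp hU) hinv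
    simpa only [Matrix.mul_assoc] using h1
  have h1 := h _ hD
  rw [jMetric_add_christoffel hP.2.isUnit] at h1
  exact (isRiemannianMetric_jMetric.pos P hP _ hD h0).ne' h1

theorem eq_jCurve_of_isGeodesicFromTo {A B : Mat 𝔻 p q} (hA : A ∈ jPositive 𝔻 p q)
    (hB : B ∈ jPositive 𝔻 p q) {δ : ℝ → Mat 𝔻 p q}
    (hδ : FlatChart.IsGeodesicFromTo (jHermitian 𝔻 p q) (jPositive 𝔻 p q) jMetric A B δ) :
    ∀ t ∈ Set.Icc (0 : ℝ) 1, δ t = jCurve A B t := by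
  obtain ⟨S, R, L, hS, hR, hSR, hRS, hSA, hL, hLB, hγ⟩ := exists_jCurve_eq hA hB
  have hI : UniqueDiffOn ℝ (Set.Icc (0 : ℝ) 1) := uniqueDiffOn_Icc one_pos
  obtain ⟨U, hUdef⟩ : ∃ U, U = derivWithin δ (Set.Icc 0 1) := ⟨_, rfl⟩
  have hU : ∀ t ∈ Set.Icc (0 : ℝ) 1, HasDerivWithinAt δ (U t) (Set.Icc 0 1) t := fun t ht => by
    rw [hUdef]
    exact (hδ.smooth.differentiableOn (by simp) t ht).hasDerivWithinAt
  have hUmem : ∀ t ∈ Set.Icc (0 : ℝ) 1, U t ∈ jHermitian 𝔻 p q := fun t ht =>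
    mem_jHermitian_of_hasDerivWithinAt (hU t ht) (hI t ht)
      (fun x hx => (hδ.mem x hx).1) ht
  have hZ : ∀ t ∈ Set.Icc (0 : ℝ) 1, HasDerivWithinAt U
      (U t * Ring.inverse (sgn 𝔻 p q * δ t) * (sgn 𝔻 p q * U t)) (Set.Icc 0 1) t :=
    fun t ht => by
    have h1 : HasDerivWithinAt U (iteratedDerivWithin 2 δ (Set.Icc 0 1) t) (Set.Icc 0 1) t := by
      rw [iteratedDerivWithin_two_eq, hUdef]
      have h2 : ContDiffOn ℝ 1 (derivWithin δ (Set.Icc 0 1)) (Set.Icc 0 1) :=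
        hδ.smooth.derivWithin hI (by norm_cast)
      exact (h2.differentiableOn (by simp) t ht).hasDerivWithinAt
    have h2 := mem_jHermitian_of_hasDerivWithinAt h1 (hI t ht) hUmem ht
    rw [← eq_of_geodesic_equation (hδ.mem t ht) (hUmem t ht) h2]
    · exact h1
    · rw [hUdef]
      exact hδ.equation t ht
  have hInv : ∀ t ∈ Set.Icc (0 : ℝ) 1,
      HasDerivWithinAt (fun t => Ring.inverse (sgn 𝔻 p q * δ t))
      (-(Ring.inverse (sgn 𝔻 p q * δ t) * (sgn 𝔻 p q * U t) * Ring.inverse (sgn 𝔻 p q * δ t)))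
      (Set.Icc 0 1) t := fun t ht => by
    obtain ⟨x, hx⟩ := (hδ.mem t ht).2.isUnit
    have h1 := (hU t ht).const_mul (sgn 𝔻 p q)
    have h2 := hasFDerivAt_ringInverse (𝕜 := ℝ) x
    rw [← hx, Ring.inverse_unit]
    rw [hx] at h2
    exact h2.comp_hasDerivWithinAt t h1
  have hQ : ∀ t ∈ Set.Icc (0 : ℝ) 1,
      Ring.inverse (sgn 𝔻 p q * δ t) * (sgn 𝔻 p q * δ t) = 1 ∧
      (sgn 𝔻 p q * δ t) * Ring.inverse (sgn 𝔻 p q * δ t) = 1 := fun t ht =>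
    ⟨Ring.inverse_mul_cancel _ (hδ.mem t ht).2.isUnit,
      Ring.mul_inverse_cancel _ (hδ.mem t ht).2.isUnit⟩
  -- `K` is the initial velocity transported to the identity by congruence with `R = (J A)^{-1/2}`.
  obtain ⟨K, hK⟩ : ∃ K, K = R * (sgn 𝔻 p q * U 0) * R := ⟨_, rfl⟩
  have h0 : (0 : ℝ) ∈ Set.Icc (0 : ℝ) 1 := ⟨le_rfl, zero_le_one⟩
  have hKherm : K.IsHermitian := by
    rw [hK]
    exact isHermitian_conj hR (mem_jHermitian_iff.mp (hUmem 0 h0))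
  have hinv0 : Ring.inverse (sgn 𝔻 p q * δ 0) = R * R := by
    rw [hδ.source, ← hSA]
    exact ringInverse_eq
      (by rw [Matrix.mul_assoc, ← Matrix.mul_assoc S R, hSR, Matrix.one_mul, hSR])
      (by rw [Matrix.mul_assoc, ← Matrix.mul_assoc R S, hRS, Matrix.one_mul, hRS])
  -- the left logarithmic derivative of a geodesic is constant
  have hconst : ∀ t ∈ Set.Icc (0 : ℝ) 1,
      Ring.inverse (sgn 𝔻 p q * δ t) * (sgn 𝔻 p q * U t) = R * K * S := by
    intro t ht
    rw [eq_of_hasDerivWithinAt_zero (f := fun t =>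
      Ring.inverse (sgn 𝔻 p q * δ t) * (sgn 𝔻 p q * U t)) ?_ t ht]
    · simp only [hinv0, hK]
      calc R * R * (sgn 𝔻 p q * U 0) = R * R * (sgn 𝔻 p q * U 0) * (R * S) := by
            rw [hRS, Matrix.mul_one]
        _ = _ := by simp only [Matrix.mul_assoc]
    · intro t ht
      -- With `Y = J δ`, the terms `-Y⁻¹ Y' Y⁻¹ Y'` and `Y⁻¹ Y''` cancel by the geodesic equation.
      refine ((hInv t ht).mul ((hZ t ht).const_mul (sgn 𝔻 p q))).congr_deriv ?_
      rw [neg_mul, neg_add_eq_zero]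
      simp only [mul_assoc]
  -- The product of `J δ` with the inverse of the expected solution has zero derivative and equals
  -- `1` at `t = 0`. This integrates the equation without an ODE uniqueness theorem.
  have hG : ∀ t ∈ Set.Icc (0 : ℝ) 1,
      (sgn 𝔻 p q * δ t) * (R * NormedSpace.exp (t • -K) * R) = 1 := by
    intro t ht
    rw [eq_of_hasDerivWithinAt_zero (f := fun t =>
      (sgn 𝔻 p q * δ t) * (R * NormedSpace.exp (t • -K) * R)) ?_ t ht]
    · simp only [zero_smul, NormedSpace.exp_zero, Matrix.mul_one, hδ.source, ← hSA]
      rw [Matrix.mul_assoc, ← Matrix.mul_assoc S R, hSR, Matrix.one_mul, hSR]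
    · intro t ht
      have h1 : sgn 𝔻 p q * U t = sgn 𝔻 p q * δ t * (R * K * S) := by
        rw [← hconst t ht, ← Matrix.mul_assoc, (hQ t ht).2, Matrix.one_mul]
      have h2 := ((hasDerivAt_exp_smul_const' (-K) t).const_mul R).mul_const R
      refine (((hU t ht).const_mul (sgn 𝔻 p q)).mul h2.hasDerivWithinAt).congr_deriv ?_
      have h3 : sgn 𝔻 p q * δ t * (R * K * S) * (R * NormedSpace.exp (t • -K) * R) =
          sgn 𝔻 p q * δ t * (R * K * (S * R) * NormedSpace.exp (t • -K) * R) := by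
        simp only [Matrix.mul_assoc]
      refine (congrArg₂ (· + ·) (congrArg (· * _) h1) rfl).trans ?_
      refine (congrArg₂ (· + ·) h3 rfl).trans ?_
      rw [hSR, mul_one]
      simp only [neg_mul, mul_neg, mul_assoc]
      exact add_neg_cancel _
  have hsol : ∀ t ∈ Set.Icc (0 : ℝ) 1,
      sgn 𝔻 p q * δ t = S * NormedSpace.exp (t • K) * S := by
    intro t ht
    have h1 : R * NormedSpace.exp (t • -K) * R * (S * NormedSpace.exp (t • K) * S) = 1 := by
      calc R * NormedSpace.exp (t • -K) * R * (S * NormedSpace.exp (t • K) * S)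
          = R * (NormedSpace.exp (t • -K) * (R * S) * NormedSpace.exp (t • K)) * S := by
            simp only [Matrix.mul_assoc]
        _ = 1 := by
            rw [hRS, Matrix.mul_one, smul_neg, ← neg_smul, exp_neg_mul_exp, Matrix.mul_one, hRS]
    exact left_inv_eq_right_inv (hG t ht) h1
  -- At `t = 1` the solution gives `exp K = R (J B) R = exp L`.
  have hKL : K = L := by
    refine exp_injOn_isHermitian hKherm hL ?_
    have h1 := hsol 1 ⟨zero_le_one, le_rfl⟩
    rw [hδ.target, one_smul] at h1
    rw [hLB, h1]
    calc NormedSpace.exp K = (R * S) * NormedSpace.exp K * (S * R) := by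
          rw [hRS, hSR, Matrix.one_mul, Matrix.mul_one]
      _ = _ := by simp only [Matrix.mul_assoc]
  intro t ht
  rw [hγ, ← hKL, ← hsol t ht, sgn_mul_sgn_mul]

/-! ### Assembly, and specialization to the three scalar algebras. -/

theorem geodesics_jPositive (𝔻 : Type) [NormedDivisionRing 𝔻] [StarRing 𝔻] [NormedAlgebra ℝ 𝔻]
    [StarModule ℝ 𝔻] [RealPart 𝔻] [StarDivisionAlgebra 𝔻] (p q : ℕ) :
    Set.BijOn jExp (jHermitian 𝔻 p q : Set (Mat 𝔻 p q)) (jPositive 𝔻 p q) ∧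
      FlatChart.IsRiemannianMetric (jHermitian 𝔻 p q) (jPositive 𝔻 p q) jMetric ∧
      ∀ A ∈ jPositive 𝔻 p q, ∀ B ∈ jPositive 𝔻 p q,
        FlatChart.IsGeodesicFromTo (jHermitian 𝔻 p q) (jPositive 𝔻 p q) jMetric A B
            (jCurve A B) ∧
          ∀ δ : ℝ → Mat 𝔻 p q,
            FlatChart.IsGeodesicFromTo (jHermitian 𝔻 p q) (jPositive 𝔻 p q) jMetric A B δ →
              ∀ t ∈ Set.Icc (0 : ℝ) 1, δ t = jCurve A B t :=
  ⟨bijOn_jExp, isRiemannianMetric_jMetric, fun _ hA _ hB =>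
    ⟨isGeodesicFromTo_jCurve hA hB, fun _ hδ => eq_jCurve_of_isGeodesicFromTo hA hB hδ⟩⟩

end JCone

end

theorem mainTheorem1 (p q : ℕ) :
    (Set.BijOn JCone.jExp (JCone.jHermitian ℝ p q : Set (JCone.Mat ℝ p q))
        (JCone.jPositive ℝ p q) ∧
      FlatChart.IsRiemannianMetric (JCone.jHermitian ℝ p q) (JCone.jPositive ℝ p q) JCone.jMetric ∧
      ∀ A ∈ JCone.jPositive ℝ p q, ∀ B ∈ JCone.jPositive ℝ p q,
        FlatChart.IsGeodesicFromTo (JCone.jHermitian ℝ p q) (JCone.jPositive ℝ p q)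
            JCone.jMetric A B (JCone.jCurve A B) ∧
          ∀ δ : ℝ → JCone.Mat ℝ p q,
            FlatChart.IsGeodesicFromTo (JCone.jHermitian ℝ p q) (JCone.jPositive ℝ p q)
                JCone.jMetric A B δ →
              ∀ t ∈ Set.Icc (0 : ℝ) 1, δ t = JCone.jCurve A B t) ∧
    (Set.BijOn JCone.jExp (JCone.jHermitian ℂ p q : Set (JCone.Mat ℂ p q))
        (JCone.jPositive ℂ p q) ∧
      FlatChart.IsRiemannianMetric (JCone.jHermitian ℂ p q) (JCone.jPositive ℂ p q) JCone.jMetric ∧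
      ∀ A ∈ JCone.jPositive ℂ p q, ∀ B ∈ JCone.jPositive ℂ p q,
        FlatChart.IsGeodesicFromTo (JCone.jHermitian ℂ p q) (JCone.jPositive ℂ p q)
            JCone.jMetric A B (JCone.jCurve A B) ∧
          ∀ δ : ℝ → JCone.Mat ℂ p q,
            FlatChart.IsGeodesicFromTo (JCone.jHermitian ℂ p q) (JCone.jPositive ℂ p q)
                JCone.jMetric A B δ →
              ∀ t ∈ Set.Icc (0 : ℝ) 1, δ t = JCone.jCurve A B t) ∧
    (Set.BijOn JCone.jExp (JCone.jHermitian (Quaternion ℝ) p q : Set (JCone.Mat (Quaternion ℝ) p q))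
        (JCone.jPositive (Quaternion ℝ) p q) ∧
      FlatChart.IsRiemannianMetric (JCone.jHermitian (Quaternion ℝ) p q) (JCone.jPositive (Quaternion ℝ) p q) JCone.jMetric ∧
      ∀ A ∈ JCone.jPositive (Quaternion ℝ) p q, ∀ B ∈ JCone.jPositive (Quaternion ℝ) p q,
        FlatChart.IsGeodesicFromTo (JCone.jHermitian (Quaternion ℝ) p q) (JCone.jPositive (Quaternion ℝ) p q)
            JCone.jMetric A B (JCone.jCurve A B) ∧
          ∀ δ : ℝ → JCone.Mat (Quaternion ℝ) p q,
            FlatChart.IsGeodesicFromTo (JCone.jHermitian (Quaternion ℝ) p q) (JCone.jPositive (Quaternion ℝ) p q)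
                JCone.jMetric A B δ →
              ∀ t ∈ Set.Icc (0 : ℝ) 1, δ t = JCone.jCurve A B t) := by
  exact ⟨JCone.geodesics_jPositive ℝ p q, JCone.geodesics_jPositive ℂ p q,
    JCone.geodesics_jPositive (Quaternion ℝ) p q⟩
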